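/- Let $M$ be a smooth (finite-dimensional, Hausdorff, second countable, boundaryless) manifold. For a contravariant antisymmetric 2-tensor $P$, seen also as a map $P:T^*M\to TM$ with $\langle P,\alpha\wedge\beta\rangle=\langle P(\alpha),\beta\rangle$, put $\{f,g\}_P=\langle P,df\wedge dg\rangle$ for functions and $$\{\alpha,\beta\}_P=L_{P(\alpha)}\beta-L_{P(\beta)}\alpha-d\langle P,\alpha\wedge\beta\rangle$$ for 1-forms. Let $(M,P,N)$ be a symplectic Poisson--Nijenhuis manifold, that is: $P$ is a smooth Poisson bivector which is the inverse $P=\omega^{-1}$ of a symplectic form $\omega$; $N:TM\to TM$ is a smooth $(1,1)$-tensor with vanishing Nijenhuis torsion, $[NX,NY]=N([NX,Y]+[X,NY]-N[X,Y])$ for all vector fields $X,Y$; and $NP=PN^*$ and $$\{\alpha,\beta\}_{NP}=\{N^*\alpha,\beta\}_P+\{\alpha,N^*\beta\}_P-N^*\{\alpha,\beta\}_P$$ for all 1-forms $\alpha,\beta$. Let $P_{j+1}=N^jP$ for $j\ge 0$, and let $\Omega^1_{ham}(M,N)$ be the space of smooth 1-forms $\alpha$ on $M$ with $d\alpha=0$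 and $d_N\alpha=0$, where $d_N=[\iota_{N^*},d]$, i.e. $d_N\alpha(X,Y)=d\alpha(NX,Y)+d\alpha(X,NY)-d(N^*\alpha)(X,Y)$. Write $\mathfrak g_j(M,N)$ for $\Omega^1_{ham}(M,N)$ with the bracket $\{\cdot,\cdot\}_{P_j}$. Call functions $\lambda_1,\dots,\lambda_n$, $n=\tfrac12\dim M$, *Nijenhuis eigenvalues* on an open dense set $M_0\subset M$ if they are real valued and of class $C^1$ on $M_0$, $\lambda_i(x)$ is an eigenvalue of $N_x$ for each $i$ and each $x\in M_0$, and $d\lambda_1,\dots,d\lambda_n$ are linearly independent at each point of $M_0$. Assume that $N$ is of maximal rank, i.e. that there are an open dense $M_0$ and Nijenhuis eigenvalues on it. Then all Nijenhuis eigenvalues $\lambda_1,\dots,\lambda_n$, on any such $M_0$, satisfy on $M_0$ $$N^*d\lambda_i=\lambda_i\,d\lambda_i\quad\text{for all } i,\qquad \{\lambda_i,\lambda_k\}_{P_j}=0\quad\text{for all } i,k \text{ and all } j\ge1.$$ Moreover, for every $j\ge 1$ the Lie algebra $\mathfrak g_j(M,N)$ is abelian: $\{\alpha,\beta\}_{P_j}=0$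 on $M$ for all $\alpha,\beta\in\Omega^1_{ham}(M,N)$. -/

import Mathlib

open scoped Manifold ContDiff
open Bundle

noncomputable section

namespace PoissonNijenhuis

variable {E : Type*} [NormedAddCommGroup E] [NormedSpace ℝ E]
  {M : Type*} [TopologicalSpace M] [ChartedSpace E M]

/-! Tensor fields on a manifold `M` modelled on `E`; smoothness is recorded separately, as smoothness
of the corresponding section of the (hom-)bundle built from the tangent bundle. -/

variable (E M) in
/-- (Not necessarily smooth) vector fields. -/
abbrev VField : Type _ := ∀ x : M, TangentSpace 𝓘(ℝ, E) x

variable (E M) in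
/-- (Not necessarily smooth) 1-forms. -/
abbrev Form1 : Type _ := ∀ x : M, TangentSpace 𝓘(ℝ, E) x →L[ℝ] ℝ

variable (E M) in
/-- (Not necessarily smooth) fields of bilinear forms on the tangent spaces, `v ↦ σ(v, ·)`. -/
abbrev BilinField : Type _ :=
  ∀ x : M, TangentSpace 𝓘(ℝ, E) x →L[ℝ] TangentSpace 𝓘(ℝ, E) x →L[ℝ] ℝ

variable (E M) in
/-- (Not necessarily smooth) `(1,1)`-tensor fields, as endomorphisms of the tangent bundle. -/
abbrev EndField : Type _ :=
  ∀ x : M, TangentSpace 𝓘(ℝ, E) x →L[ℝ] TangentSpace 𝓘(ℝ, E) x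

variable (E M) in
/-- (Not necessarily smooth) contravariant 2-tensor fields, as maps `P : T*M → TM`. -/
abbrev CoMap : Type _ :=
  ∀ x : M, (TangentSpace 𝓘(ℝ, E) x →L[ℝ] ℝ) →L[ℝ] TangentSpace 𝓘(ℝ, E) x

section Smooth

variable [IsManifold 𝓘(ℝ, E) ∞ M]

/-- Smooth vector fields. -/
def VField.IsSmooth (X : VField E M) : Prop :=
  ContMDiff 𝓘(ℝ, E) (𝓘(ℝ, E).prod 𝓘(ℝ, E)) ∞
    (fun x : M ↦ TotalSpace.mk' E (E := fun x : M ↦ TangentSpace 𝓘(ℝ, E) x) x (X x))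

/-- Smooth 1-forms. -/
def Form1.IsSmooth (α : Form1 E M) : Prop :=
  ContMDiff 𝓘(ℝ, E) (𝓘(ℝ, E).prod 𝓘(ℝ, E →L[ℝ] ℝ)) ∞
    (fun x : M ↦ TotalSpace.mk' (E →L[ℝ] ℝ)
      (E := fun x : M ↦ TangentSpace 𝓘(ℝ, E) x →L[ℝ] ℝ) x (α x))

/-- Smooth covariant 2-tensors. -/
def BilinField.IsSmooth (σ : BilinField E M) : Prop :=
  ContMDiff 𝓘(ℝ, E) (𝓘(ℝ, E).prod 𝓘(ℝ, E →L[ℝ] E →L[ℝ] ℝ)) ∞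
    (fun x : M ↦ TotalSpace.mk' (E →L[ℝ] E →L[ℝ] ℝ)
      (E := fun x : M ↦ TangentSpace 𝓘(ℝ, E) x →L[ℝ] TangentSpace 𝓘(ℝ, E) x →L[ℝ] ℝ) x (σ x))

/-- Smooth `(1,1)`-tensors. -/
def EndField.IsSmooth (N : EndField E M) : Prop :=
  ContMDiff 𝓘(ℝ, E) (𝓘(ℝ, E).prod 𝓘(ℝ, E →L[ℝ] E)) ∞
    (fun x : M ↦ TotalSpace.mk' (E →L[ℝ] E)
      (E := fun x : M ↦ TangentSpace 𝓘(ℝ, E) x →L[ℝ] TangentSpace 𝓘(ℝ, E) x) x (N x))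

/-- Smooth contravariant 2-tensors. -/
def CoMap.IsSmooth (P : CoMap E M) : Prop :=
  ContMDiff 𝓘(ℝ, E) (𝓘(ℝ, E).prod 𝓘(ℝ, (E →L[ℝ] ℝ) →L[ℝ] E)) ∞
    (fun x : M ↦ TotalSpace.mk' ((E →L[ℝ] ℝ) →L[ℝ] E)
      (E := fun x : M ↦ (TangentSpace 𝓘(ℝ, E) x →L[ℝ] ℝ) →L[ℝ] TangentSpace 𝓘(ℝ, E) x) x (P x))

end Smooth

/-! ### Pointwise operations -/

/-- The differential `df` of a function. -/
def diff (f : M → ℝ) : Form1 E M := fun x ↦ mvfderiv 𝓘(ℝ, E) f x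

/-- The derivative `X(f)` of a function along a vector field. -/
def along (X : VField E M) (f : M → ℝ) : M → ℝ := fun x ↦ mvfderiv 𝓘(ℝ, E) f x (X x)

/-- The Lie bracket of vector fields. -/
def bracket (X Y : VField E M) : VField E M := VectorField.mlieBracket 𝓘(ℝ, E) X Y

/-- The function `α(X)`. -/
def Form1.eval (α : Form1 E M) (X : VField E M) : M → ℝ := fun x ↦ α x (X x)

/-- The function `σ(X, Y)`. -/
def BilinField.eval (σ : BilinField E M) (X Y : VField E M) : M → ℝ := fun x ↦ σ x (X x) (Y x)

/-- The vector field `N X`. -/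
def EndField.app (N : EndField E M) (X : VField E M) : VField E M := fun x ↦ N x (X x)

/-- The 1-form `N* α`. -/
def EndField.dual (N : EndField E M) (α : Form1 E M) : Form1 E M := fun x ↦ (α x).comp (N x)

/-- The vector field `P(α)`. -/
def CoMap.app (P : CoMap E M) (α : Form1 E M) : VField E M := fun x ↦ P x (α x)

/-- The function `⟨P, α ∧ β⟩ = ⟨P(α), β⟩`. -/
def CoMap.pair (P : CoMap E M) (α β : Form1 E M) : M → ℝ := fun x ↦ β x (P x (α x))

/-- The composition `N P : T*M → TM`. -/
def EndField.compCo (N : EndField E M) (P : CoMap E M) : CoMap E M := fun x ↦ (N x).comp (P x)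

/-! ### Differential calculus

A differential form is given by its values on smooth vector fields. -/

/-- The de Rham differential of a 1-form:
`dα(X, Y) = X(α(Y)) - Y(α(X)) - α([X, Y])`. -/
def extD (α : Form1 E M) (X Y : VField E M) : M → ℝ :=
  along X (α.eval Y) - along Y (α.eval X) - α.eval (bracket X Y)

/-- The de Rham differential of a 2-form, evaluated on three vector fields. -/
def extD2 (σ : BilinField E M) (X Y Z : VField E M) : M → ℝ :=
  along X (σ.eval Y Z) - along Y (σ.eval X Z) + along Z (σ.eval X Y)
    - σ.eval (bracket X Y) Z + σ.eval (bracket X Z) Y - σ.eval (bracket Y Z) X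

/-- The differential `d_N = [ι_{N*}, d] = ι_{N*} d - d ι_{N*}` on 1-forms:
`d_N α(X, Y) = dα(NX, Y) + dα(X, NY) - d(N*α)(X, Y)`. -/
def extDN (N : EndField E M) (α : Form1 E M) (X Y : VField E M) : M → ℝ :=
  extD α (N.app X) Y + extD α X (N.app Y) - extD (N.dual α) X Y

/-- The Lie derivative of a 1-form: `(L_X β)(Z) = X(β(Z)) - β([X, Z])`. -/
def lieD (X : VField E M) (β : Form1 E M) (Z : VField E M) : M → ℝ :=
  along X (β.eval Z) - β.eval (bracket X Z)

/-- The bracket `{α, β}_P = L_{P(α)} β - L_{P(β)} α - d⟨P, α ∧ β⟩` of 1-forms, as a 1-form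
evaluated on the vector field `Z`. -/
def koszul (P : CoMap E M) (α β : Form1 E M) (Z : VField E M) : M → ℝ :=
  lieD (P.app α) β Z - lieD (P.app β) α Z - along Z (P.pair α β)

/-- The bracket `{f, g}_P = ⟨P, df ∧ dg⟩` of functions. -/
def poisson (P : CoMap E M) (f g : M → ℝ) : M → ℝ := P.pair (E := E) (diff f) (diff g)

/-- The tensor `P_{j+1} = N^j P` of the hierarchy defined by `P` and `N`; thus `hierarchy P N 0` is
`P_1 = P` and `hierarchy P N 1` is `P_2 = N P`. -/
def hierarchy (P : CoMap E M) (N : EndField E M) : ℕ → CoMap E M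
  | 0 => P
  | j + 1 => N.compCo (hierarchy P N j)

/-! ### Poisson-Nijenhuis structures -/

section Structures

variable [IsManifold 𝓘(ℝ, E) ∞ M]

/-- `N` is a Nijenhuis tensor: a smooth `(1,1)`-tensor with vanishing Nijenhuis torsion. -/
structure IsNijenhuis (N : EndField E M) : Prop where
  smooth : N.IsSmooth
  torsion : ∀ X Y : VField E M, X.IsSmooth → Y.IsSmooth →
    bracket (N.app X) (N.app Y)
      - N.app (bracket (N.app X) Y + bracket X (N.app Y) - N.app (bracket X Y)) = 0

/-- `P` is a Poisson bivector: smooth, antisymmetric, and the bracket of functions satisfies the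
Jacobi identity. -/
structure IsPoisson (P : CoMap E M) : Prop where
  smooth : P.IsSmooth
  antisymm : ∀ (x : M) (a b : TangentSpace 𝓘(ℝ, E) x →L[ℝ] ℝ), b (P x a) = - a (P x b)
  jacobi : ∀ f g h : M → ℝ, ContMDiff 𝓘(ℝ, E) 𝓘(ℝ) ∞ f → ContMDiff 𝓘(ℝ, E) 𝓘(ℝ) ∞ g →
    ContMDiff 𝓘(ℝ, E) 𝓘(ℝ) ∞ h →
    poisson P f (poisson P g h) + poisson P g (poisson P h f) + poisson P h (poisson P f g) = 0

/-- `(M, P, N)` is a Poisson-Nijenhuis manifold. -/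
structure IsPN (P : CoMap E M) (N : EndField E M) : Prop where
  poisson : IsPoisson P
  nijenhuis : IsNijenhuis N
  /-- `N P = P N*`. -/
  comm : ∀ (x : M) (a : TangentSpace 𝓘(ℝ, E) x →L[ℝ] ℝ), N x (P x a) = P x (a.comp (N x))
  /-- `{α, β}_{NP} = {N*α, β}_P + {α, N*β}_P - N*{α, β}_P`. -/
  compat : ∀ α β : Form1 E M, α.IsSmooth → β.IsSmooth → ∀ Z : VField E M, Z.IsSmooth →
    koszul (N.compCo P) α β Z =
      koszul P (N.dual α) β Z + koszul P α (N.dual β) Z - koszul P α β (N.app Z)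

/-- `σ` is a symplectic form: a smooth, closed, nondegenerate 2-form. -/
structure IsSymplectic (σ : BilinField E M) : Prop where
  smooth : σ.IsSmooth
  alternating : ∀ (x : M) (v : TangentSpace 𝓘(ℝ, E) x), σ x v v = 0
  nondegenerate : ∀ x : M, Function.Bijective (σ x)
  closed : ∀ X Y Z : VField E M, X.IsSmooth → Y.IsSmooth → Z.IsSmooth → extD2 σ X Y Z = 0

/-- `(M, P, N)` is a PN manifold with `P = σ⁻¹`, the inverse of the symplectic form `σ`. -/
structure IsSymplecticPN (σ : BilinField E M) (P : CoMap E M) (N : EndField E M) : Prop where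
  isPN : IsPN P N
  symplectic : IsSymplectic σ
  left_inv : ∀ (x : M) (v : TangentSpace 𝓘(ℝ, E) x), P x (σ x v) = v
  right_inv : ∀ (x : M) (a : TangentSpace 𝓘(ℝ, E) x →L[ℝ] ℝ), σ x (P x a) = a

/-- The functions `l i`, `i = 1, …, dim M / 2`, are Nijenhuis eigenvalues of `N` on the open dense
set `M₀`: they are `C¹` on `M₀`, their values are eigenvalues of `N`, and they are independent, i.e.
their differentials are linearly independent, on `M₀`. (Values outside of `M₀` play no role.) -/
structure IsNijenhuisEigenvalues (N : EndField E M) (M₀ : Set M)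
    (l : Fin (Module.finrank ℝ E / 2) → M → ℝ) : Prop where
  isOpen : IsOpen M₀
  dense : Dense M₀
  c1 : ∀ i, ContMDiffOn 𝓘(ℝ, E) 𝓘(ℝ) 1 (l i) M₀
  eigenvalue : ∀ i, ∀ x ∈ M₀,
    Module.End.HasEigenvalue
      ((N x : TangentSpace 𝓘(ℝ, E) x →ₗ[ℝ] TangentSpace 𝓘(ℝ, E) x)) (l i x)
  independent : ∀ x ∈ M₀, LinearIndependent ℝ (fun i ↦ diff (E := E) (l i) x)

/-- `N` is of maximal rank: it has `dim M / 2` independent eigenvalue functions on some open dense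
set. -/
def IsMaximalRank (N : EndField E M) : Prop :=
  ∃ (M₀ : Set M) (l : Fin (Module.finrank ℝ E / 2) → M → ℝ), IsNijenhuisEigenvalues N M₀ l

/-- The hamiltonian forms `Ω¹_ham(M, N)`: smooth 1-forms `α` with `dα = d_N α = 0`. -/
def hamiltonianForms (N : EndField E M) : Set (Form1 E M) :=
  {α | α.IsSmooth ∧ ∀ X Y : VField E M, X.IsSmooth → Y.IsSmooth →
    extD α X Y = 0 ∧ extDN N α X Y = 0}

end Structures

end PoissonNijenhuis

end

/-! Since `P` inverts a symplectic form, `NP = PN*` says that `N` is self-adjoint for `σ`, so every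
eigenspace of `N` has even dimension. Where the `n` eigenvalues are distinct, their eigenspaces each
have dimension at least 2 and therefore fill the tangent space: `N` is diagonalizable
(`iSup_eigenspace_eq_top`). Such points are dense, because eigenvalues that coincide near a point
would have equal differentials there.

At such a point let `R_i` be the product of `N - λ_k` over `k ≠ i`, a nonzero multiple of the
projection to the eigenspace `E_i`. Differentiating `R_i (N - λ_i) = 0` in a chart gives `R_i (∂_u N
v - dλ_i(u) v) = 0` for `v` in `E_i`, without any choice of differentiable eigenvector fields.
Combined with vanishing torsion on constant coordinate fields, this shows that `dλ_i` vanishes on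
`E_j` for `j ≠ i`, which is `N* dλ_i = λ_i dλ_i` (`differential_comp_eq_smul`).

If `α` is hamiltonian, then `α` and `N*α` are both closed, which forces `dλ_i ∧ α = 0` on each
`E_i`. Since `dλ_i` does not vanish, `α` is a pointwise combination of the `dλ_i`
(`eq_sum_smul_differential`). Eigen-covectors of `N*` are in involution for every `N^j P`
(`hierarchy_involution`), so `⟨P_j, α ∧ β⟩ = 0` for hamiltonian `α`, `β`. These pointwise identities
extend by continuity, and for closed forms the bracket of 1-forms is built from differentials of
such pairings, hence vanishes. -/

noncomputable section

namespace PoissonNijenhuis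

open Module

/-! ### Self-adjoint endomorphisms of a symplectic vector space -/

section LinearAlgebra

variable {V : Type*} [AddCommGroup V] [Module ℝ V] [FiniteDimensional ℝ V]

/-- A space carrying a nondegenerate alternating form is even-dimensional. -/
theorem even_finrank_of_alternating (B : V →ₗ[ℝ] V →ₗ[ℝ] ℝ) (alt : ∀ v, B v v = 0)
    (nondeg : ∀ v, (∀ w, B v w = 0) → v = 0) : Even (finrank ℝ V) := by
  have skew : ∀ v w, B v w = - B w v := by
    intro v w
    have h := alt (v + w)
    simp only [map_add, LinearMap.add_apply, alt] at h
    linarith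
  let b := finBasis ℝ V
  let G : Matrix (Fin (finrank ℝ V)) (Fin (finrank ℝ V)) ℝ := Matrix.of fun i j ↦ B (b i) (b j)
  have hG : G.transpose = -G := by
    ext i j
    exact skew _ _
  have hdet : G.det ≠ 0 := by
    intro h
    obtain ⟨c, hc, h0⟩ := Matrix.exists_mulVec_eq_zero_iff.2 h
    refine hc ?_
    have hv : ∑ j, c j • b j = 0 := by
      refine nondeg _ fun w ↦ ?_
      rw [skew, neg_eq_zero]
      have : B.flip (∑ j, c j • b j) = 0 := by
        refine b.ext fun i ↦ ?_
        have := congrFun h0 i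
        simpa [Matrix.mulVec, dotProduct, G, mul_comm] using this
      exact DFunLike.congr_fun this w
    funext j
    have := Fintype.linearIndependent_iff.1 b.linearIndependent c hv j
    simpa using this
  -- The Gram matrix is skew, so in odd dimension its determinant would equal its own negative.
  have h1 : G.det = (-1) ^ finrank ℝ V * G.det := by
    conv_lhs => rw [← Matrix.det_transpose, hG, Matrix.det_neg]
    simp
  by_contra hodd
  rw [Nat.not_even_iff_odd] at hodd
  rw [hodd.neg_one_pow] at h1
  exact hdet (by linarith)

variable {σ : V →ₗ[ℝ] V →ₗ[ℝ] ℝ} {A : End ℝ V}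

/-- The eigenspaces of an endomorphism that is self-adjoint for a symplectic form are
even-dimensional. -/
theorem even_finrank_eigenspace (alt : ∀ v, σ v v = 0) (nondeg : ∀ v, (∀ w, σ v w = 0) → v = 0)
    (adj : ∀ v w, σ (A v) w = σ v (A w)) (a : ℝ) : Even (finrank ℝ (A.eigenspace a)) := by
  have skew : ∀ v w, σ v w = - σ w v := by
    intro v w
    have h := alt (v + w)
    simp only [map_add, LinearMap.add_apply, alt] at h
    linarith
  obtain ⟨W, hW⟩ := Submodule.exists_isCompl (A.eigenspace a)
  -- Self-adjointness makes `S` alternating, and its radical is exactly the eigenspace. It is thus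
  -- nondegenerate on a complement `W`, so `W` is even-dimensional, and so is the eigenspace.
  let S : V →ₗ[ℝ] V →ₗ[ℝ] ℝ := σ ∘ₗ (A - algebraMap ℝ (End ℝ V) a)
  have hS : ∀ v w, S v w = σ (A v - a • v) w := fun v w ↦ rfl
  have Salt : ∀ v, S v v = 0 := by
    intro v
    have h1 := adj v v
    have h2 := skew v (A v)
    rw [hS, map_sub, map_smul, LinearMap.sub_apply, LinearMap.smul_apply, alt, smul_zero]
    linarith
  have Sskew : ∀ v w, S v w = - S w v := by
    intro v w
    have h := Salt (v + w)
    simp only [map_add, LinearMap.add_apply, Salt] at h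
    linarith
  have Sker : ∀ v, (∀ w, S v w = 0) → v ∈ A.eigenspace a := fun v hv ↦
    End.mem_eigenspace_iff.2 (sub_eq_zero.1 (nondeg _ hv))
  have hSker : ∀ v ∈ A.eigenspace a, ∀ w, S v w = 0 := by
    intro v hv w
    rw [hS, End.mem_eigenspace_iff.1 hv, sub_self, map_zero, LinearMap.zero_apply]
  have hWeven : Even (finrank ℝ W) := by
    refine even_finrank_of_alternating (S.domRestrict₁₂ W W) (fun w ↦ Salt w) fun v hv ↦ ?_
    have : (v : V) ∈ A.eigenspace a := by
      refine Sker v fun w ↦ ?_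
      obtain ⟨k, hk, w', hw', rfl⟩ := Submodule.mem_sup.1
        (show w ∈ A.eigenspace a ⊔ W by rw [hW.sup_eq_top]; trivial)
      rw [map_add, Sskew v k, hSker k hk, neg_zero, zero_add]
      exact hv ⟨w', hw'⟩
    have := Submodule.disjoint_def.1 hW.disjoint v this v.2
    exact_mod_cast this
  have hV := even_finrank_of_alternating σ alt nondeg
  rw [← Submodule.finrank_add_eq_of_isCompl hW, Nat.even_add] at hV
  exact hV.2 hWeven

/-- An endomorphism of a `2n`-dimensional symplectic space that is self-adjoint for the symplectic
form and has `n` distinct eigenvalues is diagonalizable. -/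
theorem iSup_eigenspace_eq_top (alt : ∀ v, σ v v = 0) (nondeg : ∀ v, (∀ w, σ v w = 0) → v = 0)
    (adj : ∀ v w, σ (A v) w = σ v (A w)) {a : Fin (finrank ℝ V / 2) → ℝ}
    (inj : Function.Injective a) (eig : ∀ i, A.HasEigenvalue (a i)) :
    ⨆ i, A.eigenspace (a i) = ⊤ := by
  classical
  have hind : iSupIndep fun i ↦ A.eigenspace (a i) := A.eigenspaces_iSupIndep.comp inj
  let f : DirectSum (Fin (finrank ℝ V / 2)) (fun i ↦ A.eigenspace (a i)) →ₗ[ℝ] V :=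
    DFinsupp.lsum ℕ fun i ↦ (A.eigenspace (a i)).subtype
  have hf : Function.Injective f := hind.dfinsupp_lsum_injective
  have hdim : finrank ℝ V ≤
      finrank ℝ (DirectSum (Fin (finrank ℝ V / 2)) (fun i ↦ A.eigenspace (a i))) := by
    rw [finrank_directSum]
    -- Nonzero and even, hence at least 2.
    have h2 : ∀ i, 2 ≤ finrank ℝ (A.eigenspace (a i)) := by
      intro i
      have h1 := even_finrank_eigenspace alt nondeg adj (a i)
      have h3 : 0 < finrank ℝ (A.eigenspace (a i)) := by
        rw [finrank_pos_iff, Submodule.nontrivial_iff_ne_bot]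
        exact eig i
      obtain ⟨r, hr⟩ := h1
      omega
    have h4 := Finset.sum_le_sum fun i (_ : i ∈ Finset.univ) ↦ h2 i
    rw [Finset.sum_const, Finset.card_univ, Fintype.card_fin, smul_eq_mul] at h4
    -- Evenness of `finrank ℝ V` ensures that the natural-number division by 2 loses nothing.
    obtain ⟨r, hr⟩ := even_finrank_of_alternating σ alt nondeg
    omega
  have hrange : LinearMap.range f = ⊤ := by
    refine Submodule.eq_top_of_finrank_eq (le_antisymm (Submodule.finrank_le _) ?_)
    rwa [LinearMap.finrank_range_of_inj hf]
  rw [Submodule.iSup_eq_range_dfinsupp_lsum]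
  exact hrange

end LinearAlgebra

/-! ### Products of `A - a k` with one factor deleted -/

section DeletedProduct

variable {V : Type*} [NormedAddCommGroup V] [NormedSpace ℝ V]

/-- The product of the operators `A - a k`, over all `k ≠ i`. -/
def deletedProd {n : ℕ} (A : V →L[ℝ] V) (a : Fin n → ℝ) (i : Fin n) : V →L[ℝ] V :=
  (((List.finRange n).filter (· ≠ i)).map fun k ↦ A - a k • (1 : V →L[ℝ] V)).prod

theorem list_prod_sub_apply {ι : Type*} (L : List ι) (A : V →L[ℝ] V) (a : ι → ℝ) {m : ℝ} {v : V}
    (hv : A v = m • v) :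
    (L.map fun k ↦ A - a k • (1 : V →L[ℝ] V)).prod v = (L.map fun k ↦ m - a k).prod • v := by
  induction L with
  | nil => simp
  | cons k L ih =>
    simp only [List.map_cons, List.prod_cons, mul_apply_eq_comp, ih, map_smul,
      sub_apply, smul_apply,
      one_apply_eq_self, hv]
    rw [← sub_smul, smul_smul, mul_comm]

variable {n : ℕ} {A : V →L[ℝ] V} {a : Fin n → ℝ}

theorem deletedProd_apply_of_ne {i j : Fin n} (hij : j ≠ i) {v : V} (hv : A v = a j • v) :
    deletedProd A a i v = 0 := by
  rw [deletedProd, list_prod_sub_apply _ A a hv, List.prod_eq_zero, zero_smul]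
  exact List.mem_map.2 ⟨j, by simp [hij], sub_self _⟩

/-- The scalar is the product of the differences `a i - a k`, nonzero because the eigenvalues are
distinct. -/
theorem deletedProd_apply_self (inj : Function.Injective a) (i : Fin n) :
    ∃ c : ℝ, c ≠ 0 ∧ ∀ v : V, A v = a i • v → deletedProd A a i v = c • v := by
  refine ⟨(((List.finRange n).filter (· ≠ i)).map fun k ↦ a i - a k).prod, ?_,
    fun v hv ↦ list_prod_sub_apply _ A a hv⟩
  rw [Ne, List.prod_eq_zero_iff]
  intro h
  obtain ⟨k, hk, h0⟩ := List.mem_map.1 h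
  have : k ≠ i := by simpa using hk
  exact this (inj (sub_eq_zero.1 h0)).symm

/-- On the `i`-th eigenspace the last factor vanishes, on every other one the deleted product does;
diagonalizability makes these cases exhaustive. -/
theorem deletedProd_mul_sub (top : ⨆ i, End.eigenspace (A : V →ₗ[ℝ] V) (a i) = ⊤) (i : Fin n) :
    deletedProd A a i * (A - a i • (1 : V →L[ℝ] V)) = 0 := by
  ext v
  refine Submodule.iSup_induction (fun i ↦ End.eigenspace (A : V →ₗ[ℝ] V) (a i))
    (motive := fun v ↦ (deletedProd A a i * (A - a i • (1 : V →L[ℝ] V))) v = 0)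
    (x := v) (by rw [top]; trivial) ?_ (map_zero _) ?_
  · intro j w hw
    have hw' : A w = a j • w := End.mem_eigenspace_iff.1 hw
    simp only [mul_apply_eq_comp, sub_apply, hw',
      smul_apply, one_apply_eq_self]
    rw [← sub_smul, map_smul]
    by_cases hij : j = i
    · rw [hij, sub_self, zero_smul]
    · rw [deletedProd_apply_of_ne hij hw', smul_zero]
  · intro x y hx hy
    rw [map_add, hx, hy, add_zero]

end DeletedProduct

/-! ### Vanishing torsion at a point of a vector space -/

section FlatNijenhuis

open Filter Topology

variable {V : Type*} [NormedAddCommGroup V] [NormedSpace ℝ V] {n : ℕ}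

/-- This is the product rule for `R_i (A - l i) = 0`, applied to `v`: the term containing the
derivative of `R_i` drops out because `A - l i` kills `v` at `z`. -/
theorem deletedProd_fderiv_sub {A : V → V →L[ℝ] V} {l : Fin n → V → ℝ} {z : V}
    (hA : DifferentiableAt ℝ A z) (hl : ∀ i, DifferentiableAt ℝ (l i) z) {i : Fin n}
    (h : ∀ᶠ y in 𝓝 z,
      deletedProd (A y) (fun k ↦ l k y) i * (A y - l i y • (1 : V →L[ℝ] V)) = 0)
    {v : V} (hv : A z v = l i z • v) (u : V) :
    deletedProd (A z) (fun k ↦ l k z) i (fderiv ℝ A z u v - fderiv ℝ (l i) z u • v) = 0 := by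
  have hS : ∀ k, HasFDerivAt (fun y ↦ A y - l k y • (1 : V →L[ℝ] V))
      (fderiv ℝ A z - (fderiv ℝ (l k) z).smulRight (1 : V →L[ℝ] V)) z := fun k ↦
    hA.hasFDerivAt.sub ((hl k).hasFDerivAt.smul_const (1 : V →L[ℝ] V))
  have hR : DifferentiableAt ℝ (fun y ↦ deletedProd (A y) (fun k ↦ l k y) i) z :=
    (HasFDerivAt.list_prod' (l := (List.finRange n).filter (· ≠ i))
      (f := fun k y ↦ A y - l k y • (1 : V →L[ℝ] V)) fun k _ ↦ hS k).differentiableAt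
  have h0 := (hR.hasFDerivAt.mul' (hS i)).unique
    ((hasFDerivAt_const (0 : V →L[ℝ] V) z).congr_of_eventuallyEq h)
  have h1 := DFunLike.congr_fun (DFunLike.congr_fun h0 u) v
  simpa [hv] using h1

variable {A : V →L[ℝ] V} {B : V →L[ℝ] V →L[ℝ] V} {a : Fin n → ℝ} {d : Fin n → V →L[ℝ] ℝ}

/-- Here `B` stands for the derivative of `A` at a point and `d i` for that of the `i`-th
eigenvalue. Apply `R_i` to the torsion identity with `v` in the `i`-th eigenspace: since `R_i A = a
i R_i`, the terms in `B v u` cancel and `(a j - a i) d i u` times a nonzero vector is left. -/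
theorem differential_apply_of_ne (inj : Function.Injective a)
    (ev : ∀ i, ∃ v : V, v ≠ 0 ∧ A v = a i • v)
    (top : ⨆ i, End.eigenspace (A : V →ₗ[ℝ] V) (a i) = ⊤)
    (hR : ∀ i v, A v = a i • v → ∀ u, deletedProd A a i (B u v - d i u • v) = 0)
    (tors : ∀ u v, B (A u) v - B (A v) u - A (B u v - B v u) = 0)
    {i j : Fin n} (hij : j ≠ i) {u : V} (hu : A u = a j • u) : d i u = 0 := by
  obtain ⟨v, hv0, hv⟩ := ev i
  obtain ⟨c, hc, hcv⟩ := deletedProd_apply_self (A := A) inj i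
  have hRA : ∀ w, deletedProd A a i (A w) = a i • deletedProd A a i w := by
    intro w
    have := DFunLike.congr_fun (deletedProd_mul_sub top i) w
    simpa [sub_eq_zero] using this
  have h1 := congrArg (deletedProd A a i) (tors u v)
  have h2 := hR i v hv u
  rw [map_sub, map_smul, hcv v hv, sub_eq_zero] at h2
  simp only [hu, hv, map_smul, smul_apply, map_sub, hRA, map_zero, h2] at h1
  have h3 : ((a j - a i) * d i u * c) • v = 0 := by
    rw [← h1]
    module
  have h4 : a j - a i ≠ 0 := sub_ne_zero.2 fun h ↦ hij (inj h)
  simpa [h4, hc, hv0] using h3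

theorem differential_comp_eq_smul (inj : Function.Injective a)
    (ev : ∀ i, ∃ v : V, v ≠ 0 ∧ A v = a i • v)
    (top : ⨆ i, End.eigenspace (A : V →ₗ[ℝ] V) (a i) = ⊤)
    (hR : ∀ i v, A v = a i • v → ∀ u, deletedProd A a i (B u v - d i u • v) = 0)
    (tors : ∀ u v, B (A u) v - B (A v) u - A (B u v - B v u) = 0) (i : Fin n) :
    (d i).comp A = a i • d i := by
  ext v
  refine Submodule.iSup_induction (fun i ↦ End.eigenspace (A : V →ₗ[ℝ] V) (a i))
    (motive := fun v ↦ (d i).comp A v = (a i • d i) v) (x := v) (by rw [top]; trivial) ?_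
    (by simp) (fun x y hx hy ↦ by rw [map_add, map_add, hx, hy])
  intro j w hw
  have hw' : A w = a j • w := End.mem_eigenspace_iff.1 hw
  by_cases hij : j = i
  · simp [hw', hij]
  · have := differential_apply_of_ne inj ev top hR tors hij hw'
    simp [hw', this]

/-- A covector annihilating the antisymmetrized derivative of `A` on each eigenspace is a linear
combination of the differentials of the eigenvalues. -/
theorem eq_sum_smul_differential (inj : Function.Injective a)
    (ev : ∀ i, ∃ v : V, v ≠ 0 ∧ A v = a i • v)
    (top : ⨆ i, End.eigenspace (A : V →ₗ[ℝ] V) (a i) = ⊤)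
    (hR : ∀ i v, A v = a i • v → ∀ u, deletedProd A a i (B u v - d i u • v) = 0)
    (tors : ∀ u v, B (A u) v - B (A v) u - A (B u v - B v u) = 0)
    (hd : ∀ i, d i ≠ 0) {α : V →L[ℝ] ℝ}
    (hα : ∀ i u v, A u = a i • u → A v = a i • v → α (B u v - B v u) = 0) :
    ∃ c : Fin n → ℝ, α = ∑ i, c i • d i := by
  have hne := fun {i j : Fin n} (hij : j ≠ i) {u : V} (hu : A u = a j • u) ↦
    differential_apply_of_ne inj ev top hR tors hij hu
  -- For `u`, `v` in one eigenspace the torsion identity puts `B u v - B v u` in that eigenspace.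
  -- There `R_i` is a nonzero scalar, so this vector equals `d i u • v - d i v • u`; then apply `α`.
  have hwedge : ∀ i u v, A u = a i • u → A v = a i • v → d i u * α v = d i v * α u := by
    intro i u v hu hv
    obtain ⟨c, hc, hcv⟩ := deletedProd_apply_self (A := A) inj i
    have h1 : A (B u v - B v u) = a i • (B u v - B v u) := by
      have := tors u v
      rw [hu, hv, map_smul, map_smul, smul_apply, smul_apply, ← smul_sub, sub_eq_zero] at this
      exact this.symm
    have h2 := hR i v hv u
    have h3 := hR i u hu v
    rw [map_sub, map_smul, hcv v hv, sub_eq_zero] at h2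
    rw [map_sub, map_smul, hcv u hu, sub_eq_zero] at h3
    have h4 := hcv _ h1
    rw [map_sub, h2, h3] at h4
    have h5 : c • (B u v - B v u) = c • (d i u • v - d i v • u) := by
      rw [← h4]
      module
    have h6 := hα i u v hu hv
    rw [smul_right_injective V hc h5, map_sub, map_smul, map_smul, sub_eq_zero] at h6
    exact h6
  -- `d i` is nonzero and vanishes on all other eigenspaces, so it is nonzero on its own; normalize
  -- there.
  have hex : ∀ i, ∃ u, A u = a i • u ∧ d i u = 1 := by
    intro i
    have : ∃ u, A u = a i • u ∧ d i u ≠ 0 := by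
      by_contra! hcon
      refine hd i ?_
      ext v
      refine Submodule.iSup_induction (fun i ↦ End.eigenspace (A : V →ₗ[ℝ] V) (a i))
        (motive := fun v ↦ d i v = 0) (x := v) (by rw [top]; trivial) ?_ (map_zero _)
        (fun x y hx hy ↦ by rw [map_add, hx, hy, add_zero])
      intro j w hw
      by_cases hij : j = i
      · exact hcon w (hij ▸ End.mem_eigenspace_iff.1 hw)
      · exact hne hij (End.mem_eigenspace_iff.1 hw)
    obtain ⟨u, hu, hdu⟩ := this
    exact ⟨(d i u)⁻¹ • u, by rw [map_smul, hu, smul_comm],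
      by rw [map_smul, smul_eq_mul, inv_mul_cancel₀ hdu]⟩
  choose u hu hdu using hex
  refine ⟨fun i ↦ α (u i), ?_⟩
  ext v
  refine Submodule.iSup_induction (fun i ↦ End.eigenspace (A : V →ₗ[ℝ] V) (a i))
    (motive := fun v ↦ α v = (∑ i, α (u i) • d i) v) (x := v) (by rw [top]; trivial) ?_
    (by simp) (fun x y hx hy ↦ by rw [map_add, map_add, hx, hy])
  intro j w hw
  have hw' : A w = a j • w := End.mem_eigenspace_iff.1 hw
  rw [sum_apply, Finset.sum_eq_single j]
  · have := hwedge j (u j) w (hu j) hw'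
    rw [hdu, one_mul] at this
    rw [this, smul_apply, smul_eq_mul, mul_comm]
  · intro i _ hij
    rw [smul_apply, hne hij.symm hw', smul_zero]
  · simp

end FlatNijenhuis

/-! ### Tensor fields and brackets read in a chart -/

section Coordinates

open Filter Topology

variable {E : Type*} [NormedAddCommGroup E] [NormedSpace ℝ E]
  {M : Type*} [TopologicalSpace M] [ChartedSpace E M]

theorem eventually_symm_mem_source (x : M) :
    ∀ᶠ z in 𝓝 (extChartAt 𝓘(ℝ, E) x x),
      (extChartAt 𝓘(ℝ, E) x).symm z ∈ (chartAt E x).source ∧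
      extChartAt 𝓘(ℝ, E) x ((extChartAt 𝓘(ℝ, E) x).symm z) = z := by
  filter_upwards [extChartAt_target_mem_nhds (I := 𝓘(ℝ, E)) x] with z hz
  refine ⟨?_, (extChartAt 𝓘(ℝ, E) x).right_inv hz⟩
  have := (extChartAt 𝓘(ℝ, E) x).map_target hz
  rwa [extChartAt_source] at this

theorem tendsto_extChartAt_symm (x : M) :
    Tendsto (extChartAt 𝓘(ℝ, E) x).symm (𝓝 (extChartAt 𝓘(ℝ, E) x x)) (𝓝 x) := by
  have := continuousAt_extChartAt_symm (I := 𝓘(ℝ, E)) x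
  rwa [ContinuousAt, extChartAt_to_inv] at this

theorem differentiableAt_comp_symm {F : Type*} [NormedAddCommGroup F] [NormedSpace ℝ F]
    {f : M → F} {x : M} {n : WithTop ℕ∞} (hn : n ≠ 0) (hf : ContMDiffAt 𝓘(ℝ, E) 𝓘(ℝ, F) n f x) :
    DifferentiableAt ℝ (f ∘ (extChartAt 𝓘(ℝ, E) x).symm) (extChartAt 𝓘(ℝ, E) x x) := by
  have := (hf.mdifferentiableAt hn).differentiableWithinAt_writtenInExtChartAt
  rw [modelWithCornersSelf_coe, Set.range_id, differentiableWithinAt_univ] at this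
  exact this

theorem mvfderiv_eq_fderiv {f : M → ℝ} {F : E → ℝ} {x : M}
    (hF : DifferentiableAt ℝ F (extChartAt 𝓘(ℝ, E) x x))
    (hf : ∀ᶠ y in 𝓝 x, f y = F (extChartAt 𝓘(ℝ, E) x y)) (u : E) :
    mvfderiv 𝓘(ℝ, E) f x u = fderiv ℝ F (extChartAt 𝓘(ℝ, E) x x) u := by
  have h : HasMFDerivAt 𝓘(ℝ, E) 𝓘(ℝ, ℝ) f x (fderiv ℝ F (extChartAt 𝓘(ℝ, E) x x)) := by
    refine ⟨?_, ?_⟩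
    · exact (hF.continuousAt.comp (continuousAt_extChartAt x)).congr
        (hf.mono fun y hy ↦ hy.symm)
    · refine HasFDerivAt.hasFDerivWithinAt (hF.hasFDerivAt.congr_of_eventuallyEq ?_)
      filter_upwards [(tendsto_extChartAt_symm x).eventually hf, eventually_symm_mem_source x]
        with z hz hz'
      rw [hz'.2] at hz
      exact hz
  rw [mvfderiv, h.mfderiv]
  rfl

variable [IsManifold 𝓘(ℝ, E) ∞ M]

variable (E) in
/-- The coordinate isomorphism from the tangent space at `y` to `E` in the chart at `x`. -/
def toCoord (x y : M) : TangentSpace 𝓘(ℝ, E) y →L[ℝ] E :=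
  (trivializationAt E (TangentSpace 𝓘(ℝ, E)) x).continuousLinearMapAt ℝ y

variable (E) in
/-- The inverse of `toCoord`. -/
def ofCoord (x y : M) : E →L[ℝ] TangentSpace 𝓘(ℝ, E) y :=
  (trivializationAt E (TangentSpace 𝓘(ℝ, E)) x).symmL ℝ y

theorem toCoord_ofCoord {x y : M} (hy : y ∈ (chartAt E x).source) (u : E) :
    toCoord E x y (ofCoord E x y u) = u :=
  (trivializationAt E (TangentSpace 𝓘(ℝ, E)) x).continuousLinearMapAt_symmL hy u

theorem ofCoord_toCoord {x y : M} (hy : y ∈ (chartAt E x).source) (v : TangentSpace 𝓘(ℝ, E) y) :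
    ofCoord E x y (toCoord E x y v) = v :=
  (trivializationAt E (TangentSpace 𝓘(ℝ, E)) x).symmL_continuousLinearMapAt hy v

theorem ofCoord_self (x : M) (u : E) : ofCoord E x x u = u := by
  rw [ofCoord, TangentBundle.symmL_trivializationAt_eq_core (mem_chart_source E x)]
  exact (tangentBundleCore 𝓘(ℝ, E) M).coordChange_self (achart E x) x (mem_chart_source E x) u

theorem toCoord_self (x : M) (v : TangentSpace 𝓘(ℝ, E) x) : toCoord E x x v = v := by
  have := ofCoord_toCoord (mem_chart_source E x) v
  rwa [ofCoord_self] at this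

/-- A `(1,1)`-tensor field read in the chart at `x`. -/
def EndField.coord (N : EndField E M) (x : M) (z : E) : E →L[ℝ] E :=
  (toCoord E x ((extChartAt 𝓘(ℝ, E) x).symm z)).comp
    ((N ((extChartAt 𝓘(ℝ, E) x).symm z)).comp (ofCoord E x ((extChartAt 𝓘(ℝ, E) x).symm z)))

/-- A 1-form read in the chart at `x`. -/
def Form1.coord (α : Form1 E M) (x : M) (z : E) : E →L[ℝ] ℝ :=
  (α ((extChartAt 𝓘(ℝ, E) x).symm z)).comp (ofCoord E x ((extChartAt 𝓘(ℝ, E) x).symm z))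

theorem EndField.coord_self (N : EndField E M) (x : M) (u : E) :
    N.coord x (extChartAt 𝓘(ℝ, E) x x) u = N x u := by
  -- The point obtained by going through the chart and back is generalized to `y`, since the types
  -- of the fibres depend on it.
  have h : ∀ y, y = x → (toCoord E x y (N y (ofCoord E x y u)) : E) = N x u := by
    rintro y rfl
    rw [ofCoord_self, toCoord_self]
  exact h _ (extChartAt_to_inv x)

theorem Form1.coord_self (α : Form1 E M) (x : M) (u : E) :
    α.coord x (extChartAt 𝓘(ℝ, E) x x) u = α x u := by
  have h : ∀ y, y = x → α y (ofCoord E x y u) = α x u := by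
    rintro y rfl
    rw [ofCoord_self]
  exact h _ (extChartAt_to_inv x)

theorem EndField.IsSmooth.differentiableAt_coord {N : EndField E M} (hN : N.IsSmooth) (x : M) :
    DifferentiableAt ℝ (N.coord x) (extChartAt 𝓘(ℝ, E) x x) := by
  have := ((contMDiffAt_hom_bundle _).1 (hN x)).2
  exact differentiableAt_comp_symm (by simp) this

theorem Form1.IsSmooth.differentiableAt_coord {α : Form1 E M} (hα : α.IsSmooth) (x : M) :
    DifferentiableAt ℝ (α.coord x) (extChartAt 𝓘(ℝ, E) x x) := by
  have := ((contMDiffAt_hom_bundle _).1 (hα x)).2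
  refine (differentiableAt_comp_symm (by simp) this).congr_of_eventuallyEq ?_
  refine Eventually.of_forall fun z ↦ ?_
  ext u
  simp [Form1.coord, ContinuousLinearMap.inCoordinates, ofCoord]
  rfl

theorem mpullbackWithin_extChartAt_symm {X : VField E M} {F : E → E} {x : M}
    (hX : ∀ᶠ y in 𝓝 x, X y = ofCoord E x y (F (extChartAt 𝓘(ℝ, E) x y))) :
    VectorField.mpullbackWithin 𝓘(ℝ, E) 𝓘(ℝ, E) (extChartAt 𝓘(ℝ, E) x).symm X
      (Set.range 𝓘(ℝ, E)) =ᶠ[𝓝 (extChartAt 𝓘(ℝ, E) x x)] F := by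
  have : IsManifold 𝓘(ℝ, E) 1 M := .of_le (n := ∞) (by simp)
  filter_upwards [(tendsto_extChartAt_symm x).eventually hX, eventually_symm_mem_source x,
    extChartAt_target_mem_nhds (I := 𝓘(ℝ, E)) x] with z hz hz' hzt
  refine (isInvertible_mfderivWithin_extChartAt_symm hzt).inverse_apply_eq.2 ?_
  rw [hz, ofCoord, TangentBundle.symmL_trivializationAt hz'.1, hz'.2]
  rfl

theorem bracket_eq_fderiv_sub {X Y : VField E M} {F G : E → E} {x : M}
    (hX : ∀ᶠ y in 𝓝 x, X y = ofCoord E x y (F (extChartAt 𝓘(ℝ, E) x y)))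
    (hY : ∀ᶠ y in 𝓝 x, Y y = ofCoord E x y (G (extChartAt 𝓘(ℝ, E) x y))) :
    bracket X Y x = fderiv ℝ G (extChartAt 𝓘(ℝ, E) x x) (F (extChartAt 𝓘(ℝ, E) x x)) -
      fderiv ℝ F (extChartAt 𝓘(ℝ, E) x x) (G (extChartAt 𝓘(ℝ, E) x x)) := by
  have : IsManifold 𝓘(ℝ, E) 1 M := .of_le (n := ∞) (by simp)
  have h := (mpullbackWithin_extChartAt_symm hX).lieBracket_vectorField_eq (𝕜 := ℝ)
    (mpullbackWithin_extChartAt_symm hY)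
  rw [bracket, ← VectorField.mlieBracketWithin_univ, VectorField.mlieBracketWithin_apply,
    mfderiv_extChartAt_self]
  refine (DFunLike.congr_fun (ContinuousLinearMap.inverse_id (R := ℝ) (M := E)) _).trans ?_
  refine Eq.trans ?_ h
  rw [Set.preimage_univ, Set.univ_inter, modelWithCornersSelf_coe, Set.range_id]
  exact congrFun VectorField.lieBracketWithin_univ _

/-- Torsion and closedness are tested on global smooth fields only; a bump function extends a
constant coordinate field to one. -/
theorem exists_smooth_eventuallyEq [FiniteDimensional ℝ E] [T2Space M] (x : M) (u : E) :
    ∃ X : VField E M, X.IsSmooth ∧ X x = u ∧ ∀ᶠ y in 𝓝 x, X y = ofCoord E x y u := by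
  obtain ⟨f⟩ : Nonempty (SmoothBumpFunction 𝓘(ℝ, E) x) := inferInstance
  have hev : ∀ᶠ y in 𝓝 x, f y • ofCoord E x y u = ofCoord E x y u := by
    filter_upwards [f.eventuallyEq_one] with y hy
    rw [hy, Pi.one_apply, one_smul]
  refine ⟨fun y ↦ f y • ofCoord E x y u, ?_, ?_, hev⟩
  · refine ContMDiffOn.smul_section_of_tsupport f.contMDiff.contMDiffOn (chartAt E x).open_source
      f.tsupport_subset_chartAt_source ?_
    intro y hy
    rw [(trivializationAt E (TangentSpace 𝓘(ℝ, E)) x).contMDiffWithinAt_section _ hy]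
    refine (contMDiffWithinAt_const (c := u)).congr_of_eventuallyEq_of_mem ?_ hy
    filter_upwards [self_mem_nhdsWithin] with z hz
    refine Eq.trans ?_ (toCoord_ofCoord hz u)
    exact ((trivializationAt E (TangentSpace 𝓘(ℝ, E)) x).continuousLinearMapAt_apply_of_mem ℝ hz
      _).symm
  · exact hev.self_of_nhds.trans (ofCoord_self x u)

end Coordinates

/-! ### Exterior derivative and torsion on constant coordinate fields -/

section CoordinateFormulas

open Filter Topology

variable {E : Type*} [NormedAddCommGroup E] [NormedSpace ℝ E]
  {M : Type*} [TopologicalSpace M] [ChartedSpace E M] [IsManifold 𝓘(ℝ, E) ∞ M]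

theorem EndField.coord_extChartAt (N : EndField E M) {x y : M} (hy : y ∈ (chartAt E x).source)
    (u : E) : N.coord x (extChartAt 𝓘(ℝ, E) x y) u = toCoord E x y (N y (ofCoord E x y u)) := by
  have h : ∀ y', y' = y → toCoord E x y' (N y' (ofCoord E x y' u)) =
      toCoord E x y (N y (ofCoord E x y u)) := by
    rintro y' rfl
    rfl
  exact h _ ((extChartAt 𝓘(ℝ, E) x).left_inv (by rwa [extChartAt_source]))

theorem Form1.coord_extChartAt (α : Form1 E M) {x y : M} (hy : y ∈ (chartAt E x).source)
    (u : E) : α.coord x (extChartAt 𝓘(ℝ, E) x y) u = α y (ofCoord E x y u) := by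
  have h : ∀ y', y' = y → α y' (ofCoord E x y' u) = α y (ofCoord E x y u) := by
    rintro y' rfl
    rfl
  exact h _ ((extChartAt 𝓘(ℝ, E) x).left_inv (by rwa [extChartAt_source]))

theorem EndField.app_eventuallyEq (N : EndField E M) {X : VField E M} {F : E → E} {x : M}
    (hX : ∀ᶠ y in 𝓝 x, X y = ofCoord E x y (F (extChartAt 𝓘(ℝ, E) x y))) :
    ∀ᶠ y in 𝓝 x, N.app X y = ofCoord E x y
      ((fun z ↦ N.coord x z (F z)) (extChartAt 𝓘(ℝ, E) x y)) := by
  filter_upwards [hX, chart_source_mem_nhds E x] with y hy hys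
  rw [N.coord_extChartAt hys, ofCoord_toCoord hys, EndField.app, hy]

theorem Form1.eval_eventuallyEq (α : Form1 E M) {X : VField E M} {F : E → E} {x : M}
    (hX : ∀ᶠ y in 𝓝 x, X y = ofCoord E x y (F (extChartAt 𝓘(ℝ, E) x y))) :
    ∀ᶠ y in 𝓝 x, α.eval X y = (fun z ↦ α.coord x z (F z)) (extChartAt 𝓘(ℝ, E) x y) := by
  filter_upwards [hX, chart_source_mem_nhds E x] with y hy hys
  rw [α.coord_extChartAt hys, Form1.eval, hy]

theorem EndField.dual_coord (N : EndField E M) (α : Form1 E M) (x : M) :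
    ∀ᶠ z in 𝓝 (extChartAt 𝓘(ℝ, E) x x),
      (N.dual α).coord x z = (α.coord x z).comp (N.coord x z) := by
  filter_upwards [eventually_symm_mem_source x] with z hz
  ext u
  change α _ (N _ (ofCoord E x _ u)) = α _ (ofCoord E x _ (toCoord E x _ (N _ (ofCoord E x _ u))))
  rw [ofCoord_toCoord hz.1]

theorem fderiv_apply_const {F : Type*} [NormedAddCommGroup F] [NormedSpace ℝ F]
    {A : E → E →L[ℝ] F} {z : E} (hA : DifferentiableAt ℝ A z) (u w : E) :
    fderiv ℝ (fun z ↦ A z u) z w = fderiv ℝ A z w u := by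
  have := hA.hasFDerivAt.clm_apply (hasFDerivAt_const u z)
  rw [this.fderiv]
  simp

theorem extD_coord {α : Form1 E M} {x : M}
    (hα : DifferentiableAt ℝ (α.coord x) (extChartAt 𝓘(ℝ, E) x x)) {X Y : VField E M} {u v : E}
    (hX : ∀ᶠ y in 𝓝 x, X y = ofCoord E x y u) (hY : ∀ᶠ y in 𝓝 x, Y y = ofCoord E x y v) :
    extD α X Y x = fderiv ℝ (α.coord x) (extChartAt 𝓘(ℝ, E) x x) u v
      - fderiv ℝ (α.coord x) (extChartAt 𝓘(ℝ, E) x x) v u := by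
  replace hX : ∀ᶠ y in 𝓝 x, X y = ofCoord E x y ((fun _ ↦ u) (extChartAt 𝓘(ℝ, E) x y)) := hX
  replace hY : ∀ᶠ y in 𝓝 x, Y y = ofCoord E x y ((fun _ ↦ v) (extChartAt 𝓘(ℝ, E) x y)) := hY
  have hX0 : X x = u := hX.self_of_nhds.trans (ofCoord_self x u)
  have hY0 : Y x = v := hY.self_of_nhds.trans (ofCoord_self x v)
  have h4 := bracket_eq_fderiv_sub (X := X) (Y := Y) (x := x)
    (F := fun _ ↦ u) (G := fun _ ↦ v) hX hY
  simp only [fderiv_fun_const, Pi.zero_apply, zero_apply, sub_zero] at h4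
  have hc : ∀ w : E, DifferentiableAt ℝ (fun z ↦ α.coord x z w) (extChartAt 𝓘(ℝ, E) x x) :=
    fun w ↦ hα.clm_apply (differentiableAt_const w)
  have h1 := mvfderiv_eq_fderiv (hc v) (α.eval_eventuallyEq (F := fun _ ↦ v) hY) u
  have h2 := mvfderiv_eq_fderiv (hc u) (α.eval_eventuallyEq (F := fun _ ↦ u) hX) v
  rw [fderiv_apply_const hα] at h1 h2
  have h : extD α X Y x = mvfderiv 𝓘(ℝ, E) (α.eval Y) x (X x) - mvfderiv 𝓘(ℝ, E) (α.eval X) x (Y x)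
    - α x (bracket X Y x) := rfl
  rw [h, h4, hX0, hY0, h1, h2]
  have h5 : α x (0 : E) = 0 := map_zero (α x)
  erw [h5, sub_zero]

variable [FiniteDimensional ℝ E] [T2Space M]

theorem IsNijenhuis.torsion_coord {N : EndField E M} (hN : IsNijenhuis N) (x : M) (u v : E) :
    let z := extChartAt 𝓘(ℝ, E) x x
    fderiv ℝ (N.coord x) z (N.coord x z u) v - fderiv ℝ (N.coord x) z (N.coord x z v) u
      - N.coord x z (fderiv ℝ (N.coord x) z u v - fderiv ℝ (N.coord x) z v u) = 0 := by
  intro z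
  obtain ⟨X, hXs, -, hX⟩ := exists_smooth_eventuallyEq x u
  obtain ⟨Y, hYs, -, hY⟩ := exists_smooth_eventuallyEq x v
  replace hX : ∀ᶠ y in 𝓝 x, X y = ofCoord E x y ((fun _ ↦ u) (extChartAt 𝓘(ℝ, E) x y)) := hX
  replace hY : ∀ᶠ y in 𝓝 x, Y y = ofCoord E x y ((fun _ ↦ v) (extChartAt 𝓘(ℝ, E) x y)) := hY
  have hd := hN.smooth.differentiableAt_coord x
  have hNX := N.app_eventuallyEq (F := fun _ ↦ u) hX
  have hNY := N.app_eventuallyEq (F := fun _ ↦ v) hY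
  have h1 := bracket_eq_fderiv_sub (X := N.app X) (Y := N.app Y) (x := x)
    (F := fun z ↦ N.coord x z u) (G := fun z ↦ N.coord x z v)
    hNX hNY
  have h2 := bracket_eq_fderiv_sub (X := N.app X) (Y := Y) (x := x)
    (F := fun z ↦ N.coord x z u) (G := fun _ ↦ v) hNX hY
  have h3 := bracket_eq_fderiv_sub (X := X) (Y := N.app Y) (x := x)
    (F := fun _ ↦ u) (G := fun z ↦ N.coord x z v) hX hNY
  have h4 := bracket_eq_fderiv_sub (X := X) (Y := Y) (x := x)
    (F := fun _ ↦ u) (G := fun _ ↦ v) hX hY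
  simp only [fderiv_apply_const hd, fderiv_fun_const, Pi.zero_apply, zero_apply, sub_zero,
    zero_sub] at h1 h2 h3 h4
  have h : ∀ b₁ b₂ b₃ b₄ : E, bracket (N.app X) (N.app Y) x = b₁ → bracket (N.app X) Y x = b₂ →
      bracket X (N.app Y) x = b₃ → bracket X Y x = b₄ →
      b₁ - N.coord x z (b₂ + b₃ - N.coord x z b₄) = 0 := by
    have hA : N.coord x z = N x := ContinuousLinearMap.ext (N.coord_self x)
    rw [hA]
    rintro _ _ _ _ rfl rfl rfl rfl
    exact congrFun (hN.torsion X Y hXs hYs) x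
  have h' := h _ _ _ _ h1 h2 h3 h4
  rwa [map_zero, sub_zero, neg_add_eq_sub] at h'

end CoordinateFormulas

/-! ### Points with distinct eigenvalues -/

section Regular

open Filter Topology Module

variable {E : Type*} [NormedAddCommGroup E] [NormedSpace ℝ E]
  {M : Type*} [TopologicalSpace M] [ChartedSpace E M]
  {σ : BilinField E M} {P : CoMap E M} {N : EndField E M}

variable {M₀ : Set M} {l : Fin (finrank ℝ E / 2) → M → ℝ}

/-- The points of `M₀` at which the eigenvalues are pairwise distinct. -/
def regularSet (M₀ : Set M) (l : Fin (finrank ℝ E / 2) → M → ℝ) : Set M :=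
  {x | x ∈ M₀ ∧ Function.Injective fun i ↦ l i x}

theorem IsNijenhuisEigenvalues.contMDiffAt (hl : IsNijenhuisEigenvalues N M₀ l)
    (i : Fin (finrank ℝ E / 2)) {x : M} (hx : x ∈ M₀) :
    ContMDiffAt 𝓘(ℝ, E) 𝓘(ℝ) 1 (l i) x :=
  (hl.c1 i).contMDiffAt (hl.isOpen.mem_nhds hx)

theorem IsNijenhuisEigenvalues.regularSet_mem_nhds (hl : IsNijenhuisEigenvalues N M₀ l)
    {x : M} (hx : x ∈ regularSet M₀ l) : regularSet M₀ l ∈ 𝓝 x := by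
  have h : ∀ᶠ y in 𝓝 x, ∀ i k, i ≠ k → l i y ≠ l k y := by
    simp only [eventually_all]
    intro i k hik
    filter_upwards [((hl.contMDiffAt i hx.1).continuousAt.sub
      (hl.contMDiffAt k hx.1).continuousAt).eventually_ne
        (sub_ne_zero.2 fun h ↦ hik (hx.2 h))] with y hy
    exact sub_ne_zero.1 hy
  filter_upwards [h, hl.isOpen.mem_nhds hx.1] with y hy hy0
  refine ⟨hy0, fun i k hik ↦ ?_⟩
  by_contra hne
  exact hy i k hne hik

theorem IsNijenhuisEigenvalues.dense_regularSet (hl : IsNijenhuisEigenvalues N M₀ l) :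
    Dense (regularSet M₀ l) := by
  have hopen : ∀ i k, IsOpen {x | x ∈ M₀ ∧ l i x ≠ l k x} := by
    intro i k
    rw [isOpen_iff_mem_nhds]
    rintro x ⟨hx, hne⟩
    filter_upwards [hl.isOpen.mem_nhds hx, ((hl.contMDiffAt i hx).continuousAt.sub
      (hl.contMDiffAt k hx).continuousAt).eventually_ne (sub_ne_zero.2 hne)] with y hy hy'
    exact ⟨hy, sub_ne_zero.1 hy'⟩
  have hdense : ∀ i k, i ≠ k → Dense {x | x ∈ M₀ ∧ l i x ≠ l k x} := by
    intro i k hik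
    rw [dense_iff_inter_open]
    intro U hU hUne
    obtain ⟨x, hxU, hx0⟩ := hl.dense.inter_open_nonempty U hU hUne
    by_contra hcon
    have heq : l i =ᶠ[𝓝 x] l k := by
      filter_upwards [hU.mem_nhds hxU, hl.isOpen.mem_nhds hx0] with y hyU hy0
      by_contra hne
      exact hcon ⟨y, hyU, hy0, hne⟩
    refine hik ((hl.independent x hx0).injective ?_)
    simp only [diff, mvfderiv, heq.mfderiv_eq]
    rfl
  -- Openness is carried through the induction because two dense sets meet in a dense set once one
  -- of them is open.
  have key : ∀ s : Finset (Fin (finrank ℝ E / 2) × Fin (finrank ℝ E / 2)),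
      (∀ p ∈ s, p.1 ≠ p.2) →
      IsOpen {x | x ∈ M₀ ∧ ∀ p ∈ s, l p.1 x ≠ l p.2 x} ∧
      Dense {x | x ∈ M₀ ∧ ∀ p ∈ s, l p.1 x ≠ l p.2 x} := by
    intro s
    induction s using Finset.induction_on with
    | empty => simpa using ⟨hl.isOpen, hl.dense⟩
    | insert p s hp ih =>
      intro hs
      obtain ⟨h1, h2⟩ := ih fun q hq ↦ hs q (Finset.mem_insert_of_mem hq)
      have h3 : {x | x ∈ M₀ ∧ ∀ q ∈ insert p s, l q.1 x ≠ l q.2 x} =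
          {x | x ∈ M₀ ∧ l p.1 x ≠ l p.2 x} ∩ {x | x ∈ M₀ ∧ ∀ q ∈ s, l q.1 x ≠ l q.2 x} := by
        ext x
        simp only [Finset.forall_mem_insert, Set.mem_ofPred_eq, Set.mem_inter_iff]
        tauto
      rw [h3]
      exact ⟨(hopen _ _).inter h1,
        (hdense _ _ (hs p (Finset.mem_insert_self _ _))).inter_of_isOpen_left h2 (hopen _ _)⟩
  refine (key (Finset.univ.filter fun p ↦ p.1 ≠ p.2) (by simp)).2.mono ?_
  rintro x ⟨hx0, hx⟩
  refine ⟨hx0, fun i k hik ↦ ?_⟩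
  by_contra hne
  exact hx (i, k) (by simpa using hne) hik

theorem IsNijenhuisEigenvalues.diff_eq_fderiv (hl : IsNijenhuisEigenvalues N M₀ l)
    (i : Fin (finrank ℝ E / 2)) {x : M} (hx : x ∈ M₀) :
    diff (l i) x = fderiv ℝ (l i ∘ (extChartAt 𝓘(ℝ, E) x).symm) (extChartAt 𝓘(ℝ, E) x x) := by
  refine ContinuousLinearMap.ext fun u ↦ mvfderiv_eq_fderiv
    (differentiableAt_comp_symm one_ne_zero (hl.contMDiffAt i hx)) ?_ u
  filter_upwards [extChartAt_source_mem_nhds (I := 𝓘(ℝ, E)) x] with y hy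
  rw [Function.comp_apply, (extChartAt 𝓘(ℝ, E) x).left_inv hy]

variable [IsManifold 𝓘(ℝ, E) ∞ M]

/-- This is `NP = PN*` conjugated by `σ = P⁻¹`. -/
theorem IsSymplecticPN.adjoint (h : IsSymplecticPN σ P N) (x : M)
    (v w : TangentSpace 𝓘(ℝ, E) x) : σ x (N x v) w = σ x v (N x w) := by
  have h1 := h.isPN.comm x (σ x v)
  rw [h.left_inv] at h1
  rw [h1, h.right_inv]
  rfl

theorem exists_coord_eigenvector {x y : M} (hy : y ∈ (chartAt E x).source) {a : ℝ}
    (ha : End.HasEigenvalue (N y : TangentSpace 𝓘(ℝ, E) y →ₗ[ℝ] TangentSpace 𝓘(ℝ, E) y) a) :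
    ∃ v : E, v ≠ 0 ∧ ((toCoord E x y).comp ((N y).comp (ofCoord E x y))) v = a • v := by
  obtain ⟨v, hv⟩ := ha.exists_hasEigenvector
  have hv1 : N y v = a • v := End.mem_eigenspace_iff.1 hv.1
  refine ⟨toCoord E x y v, fun h0 ↦ hv.2 ?_, ?_⟩
  · rw [← ofCoord_toCoord hy v, h0, map_zero]
  · change toCoord E x y (N y (ofCoord E x y (toCoord E x y v))) = _
    rw [ofCoord_toCoord hy, hv1, map_smul]

theorem IsSymplecticPN.iSup_coord_eigenspace [FiniteDimensional ℝ E] (h : IsSymplecticPN σ P N)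
    {x y : M} (hy : y ∈ (chartAt E x).source) {a : Fin (finrank ℝ E / 2) → ℝ}
    (inj : Function.Injective a) (ha : ∀ i, End.HasEigenvalue
      (N y : TangentSpace 𝓘(ℝ, E) y →ₗ[ℝ] TangentSpace 𝓘(ℝ, E) y) (a i)) :
    ⨆ i, End.eigenspace (((toCoord E x y).comp ((N y).comp (ofCoord E x y)) : E →L[ℝ] E) :
      E →ₗ[ℝ] E) (a i) = ⊤ := by
  let s : E →ₗ[ℝ] E →ₗ[ℝ] ℝ := LinearMap.mk₂ ℝ
    (fun u v ↦ σ y (ofCoord E x y u) (ofCoord E x y v))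
    (fun u u' v ↦ by rw [map_add, map_add, add_apply])
    (fun c u v ↦ by rw [map_smul, map_smul, smul_apply])
    (fun u v v' ↦ by rw [map_add, map_add]) (fun c u v ↦ by rw [map_smul, map_smul])
  have hs : ∀ u v, s u v = σ y (ofCoord E x y u) (ofCoord E x y v) := fun u v ↦ rfl
  refine iSup_eigenspace_eq_top (σ := s) (fun v ↦ h.symplectic.alternating y _) ?_ ?_ inj ?_
  · intro v hv
    have h0 : σ y (ofCoord E x y v) = σ y 0 := by
      rw [map_zero]
      ext w
      rw [← ofCoord_toCoord hy w, ← hs, hv]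
      rfl
    rw [← toCoord_ofCoord hy v, (h.symplectic.nondegenerate y).1 h0, map_zero]
  · intro v w
    rw [hs, hs]
    change σ y (ofCoord E x y (toCoord E x y (N y (ofCoord E x y v)))) (ofCoord E x y w) =
      σ y (ofCoord E x y v) (ofCoord E x y (toCoord E x y (N y (ofCoord E x y w))))
    rw [ofCoord_toCoord hy, ofCoord_toCoord hy, h.adjoint]
  · intro i
    obtain ⟨v, hv0, hv⟩ := exists_coord_eigenvector hy (ha i)
    exact End.hasEigenvalue_of_hasEigenvector ⟨End.mem_eigenspace_iff.2 hv, hv0⟩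

theorem IsNijenhuisEigenvalues.exists_eigenvector (hl : IsNijenhuisEigenvalues N M₀ l)
    {x : M} (hx : x ∈ M₀) (i : Fin (finrank ℝ E / 2)) :
    ∃ v : E, v ≠ 0 ∧ N.coord x (extChartAt 𝓘(ℝ, E) x x) v = l i x • v := by
  have h0 := extChartAt_to_inv (I := 𝓘(ℝ, E)) x
  refine exists_coord_eigenvector ?_ ?_
  · rw [h0]
    exact mem_chart_source E x
  · rw [h0]
    exact hl.eigenvalue i _ hx

variable [FiniteDimensional ℝ E]

theorem IsNijenhuisEigenvalues.deletedProd_fderiv_coord (hl : IsNijenhuisEigenvalues N M₀ l)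
    (h : IsSymplecticPN σ P N) {x : M} (hx : x ∈ regularSet M₀ l) (i : Fin (finrank ℝ E / 2))
    (v : E) (hv : N.coord x (extChartAt 𝓘(ℝ, E) x x) v = l i x • v) (u : E) :
    deletedProd (N.coord x (extChartAt 𝓘(ℝ, E) x x)) (fun k ↦ l k x) i
      (fderiv ℝ (N.coord x) (extChartAt 𝓘(ℝ, E) x x) u v -
        fderiv ℝ (l i ∘ (extChartAt 𝓘(ℝ, E) x).symm) (extChartAt 𝓘(ℝ, E) x x) u • v) = 0 := by
  have hl0 : ∀ k, (l k ∘ (extChartAt 𝓘(ℝ, E) x).symm) (extChartAt 𝓘(ℝ, E) x x) = l k x :=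
    fun k ↦ congrArg (l k) (extChartAt_to_inv x)
  have := deletedProd_fderiv_sub (A := N.coord x)
    (l := fun k ↦ l k ∘ (extChartAt 𝓘(ℝ, E) x).symm) (i := i)
    (h.isPN.nijenhuis.smooth.differentiableAt_coord x)
    (fun k ↦ differentiableAt_comp_symm one_ne_zero (hl.contMDiffAt k hx.1)) ?_ (v := v)
    (by simpa only [hl0] using hv) u
  · simpa only [hl0] using this
  -- The identity must hold near the point in order to be differentiated; regularity is an open
  -- condition.
  · filter_upwards [eventually_symm_mem_source x,
      (tendsto_extChartAt_symm x).eventually (hl.regularSet_mem_nhds hx)] with z hz hzr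
    exact deletedProd_mul_sub (a := fun k ↦ l k ((extChartAt 𝓘(ℝ, E) x).symm z))
      (h.iSup_coord_eigenspace hz.1 hzr.2 fun k ↦ hl.eigenvalue k _ hzr.1) i

theorem IsNijenhuisEigenvalues.iSup_eigenspace (hl : IsNijenhuisEigenvalues N M₀ l)
    (h : IsSymplecticPN σ P N) {x : M} (hx : x ∈ regularSet M₀ l) :
    ⨆ i, End.eigenspace (N.coord x (extChartAt 𝓘(ℝ, E) x x) : E →ₗ[ℝ] E) (l i x) = ⊤ := by
  have h0 := extChartAt_to_inv (I := 𝓘(ℝ, E)) x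
  refine h.iSup_coord_eigenspace (a := fun i ↦ l i x) ?_ hx.2 ?_
  · rw [h0]
    exact mem_chart_source E x
  · rw [h0]
    exact fun k ↦ hl.eigenvalue k _ hx.1

variable [T2Space M]

theorem IsNijenhuisEigenvalues.dual_diff_of_regular (hl : IsNijenhuisEigenvalues N M₀ l)
    (h : IsSymplecticPN σ P N) {x : M} (hx : x ∈ regularSet M₀ l) (i : Fin (finrank ℝ E / 2)) :
    N.dual (diff (l i)) x = l i x • diff (l i) x := by
  have := differential_comp_eq_smul hx.2 (hl.exists_eigenvector hx.1) (hl.iSup_eigenspace h hx)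
    (hl.deletedProd_fderiv_coord h hx) (h.isPN.nijenhuis.torsion_coord x) i
  have hA : N.coord x (extChartAt 𝓘(ℝ, E) x x) = N x := ContinuousLinearMap.ext (N.coord_self x)
  rw [hA, ← hl.diff_eq_fderiv i hx.1] at this
  exact this

/-- Closedness of `α` and `d_N α = 0` make `N*α` closed. Expanding `d(N*α)(u, v)` by the product
rule gives the expression in question plus `a • dα(u, v)`, which is zero. -/
theorem hamiltonian_apply_eq_zero {α : Form1 E M} (hN : IsNijenhuis N)
    (hα : α ∈ hamiltonianForms N) {x : M} {a : ℝ} {u v : E}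
    (hu : N.coord x (extChartAt 𝓘(ℝ, E) x x) u = a • u)
    (hv : N.coord x (extChartAt 𝓘(ℝ, E) x x) v = a • v) :
    α.coord x (extChartAt 𝓘(ℝ, E) x x) (fderiv ℝ (N.coord x) (extChartAt 𝓘(ℝ, E) x x) u v
      - fderiv ℝ (N.coord x) (extChartAt 𝓘(ℝ, E) x x) v u) = 0 := by
  obtain ⟨X, hXs, -, hX⟩ := exists_smooth_eventuallyEq x u
  obtain ⟨Y, hYs, -, hY⟩ := exists_smooth_eventuallyEq x v
  have hNX : (N.app X).IsSmooth := fun y ↦ (hN.smooth y).clm_bundle_apply (hXs y)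
  have hNY : (N.app Y).IsSmooth := fun y ↦ (hN.smooth y).clm_bundle_apply (hYs y)
  have hdA := hN.smooth.differentiableAt_coord x
  have hdα := hα.1.differentiableAt_coord x
  have h1 : extD α X Y x = 0 := congrFun (hα.2 X Y hXs hYs).1 x
  have h2 : extD (N.dual α) X Y x = 0 := by
    have h3 := (hα.2 X Y hXs hYs).2
    rw [extDN, (hα.2 _ _ hNX hYs).1, (hα.2 _ _ hXs hNY).1, zero_add, zero_sub,
      neg_eq_zero] at h3
    exact congrFun h3 x
  have hd := (hdα.hasFDerivAt.clm_comp hdA.hasFDerivAt).congr_of_eventuallyEq (N.dual_coord α x)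
  rw [extD_coord hdα hX hY] at h1
  rw [extD_coord hd.differentiableAt hX hY, hd.fderiv] at h2
  change α.coord x _ (fderiv ℝ (N.coord x) _ u v) + fderiv ℝ (α.coord x) _ u (N.coord x _ v)
    - (α.coord x _ (fderiv ℝ (N.coord x) _ v u) + fderiv ℝ (α.coord x) _ v (N.coord x _ u)) = 0
    at h2
  rw [hu, hv, map_smul, map_smul, smul_eq_mul, smul_eq_mul] at h2
  rw [map_sub]
  linear_combination h2 - a * h1

theorem IsNijenhuisEigenvalues.exists_eq_sum_of_regular (hl : IsNijenhuisEigenvalues N M₀ l)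
    (h : IsSymplecticPN σ P N) {x : M} (hx : x ∈ regularSet M₀ l) {α : Form1 E M}
    (hα : α ∈ hamiltonianForms N) :
    ∃ c : Fin (finrank ℝ E / 2) → ℝ, α x = ∑ i, c i • diff (l i) x := by
  have hd := fun i ↦ hl.diff_eq_fderiv i hx.1
  obtain ⟨c, hc⟩ := eq_sum_smul_differential hx.2 (hl.exists_eigenvector hx.1)
    (hl.iSup_eigenspace h hx) (hl.deletedProd_fderiv_coord h hx)
    (h.isPN.nijenhuis.torsion_coord x)
    (fun i ↦ by rw [← hd]; exact (hl.independent x hx.1).ne_zero i)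
    (α := α.coord x (extChartAt 𝓘(ℝ, E) x x))
    (fun i u v hu hv ↦ hamiltonian_apply_eq_zero h.isPN.nijenhuis hα hu hv)
  refine ⟨c, ?_⟩
  have hA : α.coord x (extChartAt 𝓘(ℝ, E) x x) = α x := ContinuousLinearMap.ext (α.coord_self x)
  rw [hA] at hc
  simp only [hd]
  exact hc

end Regular

/-! ### Involution of eigen-covectors -/

section Hierarchy

variable {E : Type*} [NormedAddCommGroup E] [NormedSpace ℝ E]
  {M : Type*} [TopologicalSpace M] [ChartedSpace E M]
  {P : CoMap E M} {N : EndField E M}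

theorem hierarchy_apply_of_eigen (comm : ∀ (x : M) (a : TangentSpace 𝓘(ℝ, E) x →L[ℝ] ℝ),
      N x (P x a) = P x (a.comp (N x))) (j : ℕ) {x : M} {a : TangentSpace 𝓘(ℝ, E) x →L[ℝ] ℝ} {m : ℝ}
    (ha : a.comp (N x) = m • a) : hierarchy P N j x a = m ^ j • P x a := by
  induction j with
  | zero => rw [pow_zero, one_smul]; rfl
  | succ j ih =>
    change N x (hierarchy P N j x a) = _
    rw [ih, map_smul, comm, ha, map_smul, smul_smul, pow_succ]

/-- Eigen-covectors of `N*` for distinct eigenvalues are in involution, as is each of them with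
itself. -/
theorem hierarchy_involution (comm : ∀ (x : M) (a : TangentSpace 𝓘(ℝ, E) x →L[ℝ] ℝ),
      N x (P x a) = P x (a.comp (N x)))
    (antisymm : ∀ (x : M) (a b : TangentSpace 𝓘(ℝ, E) x →L[ℝ] ℝ), b (P x a) = - a (P x b))
    (j : ℕ) {x : M} {a b : TangentSpace 𝓘(ℝ, E) x →L[ℝ] ℝ} {m r : ℝ}
    (ha : a.comp (N x) = m • a) (hb : b.comp (N x) = r • b) (hab : m ≠ r ∨ a = b) :
    b (hierarchy P N j x a) = 0 := by
  have h : b (P x a) = 0 := by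
    rcases hab with hmr | rfl
    · have h1 : b (N x (P x a)) = r * b (P x a) := DFunLike.congr_fun hb (P x a)
      rw [comm, ha, map_smul, map_smul, smul_eq_mul] at h1
      have h2 : (m - r) * b (P x a) = 0 := by linear_combination h1
      exact (mul_eq_zero.1 h2).resolve_left (sub_ne_zero.2 hmr)
    · linarith [antisymm x a a]
  rw [hierarchy_apply_of_eigen comm j ha, map_smul, h, smul_zero]

end Hierarchy

/-! ### Extension from regular points by continuity -/

section Continuity

open Filter Topology Module

variable {E : Type*} [NormedAddCommGroup E] [NormedSpace ℝ E]
  {M : Type*} [TopologicalSpace M] [ChartedSpace E M]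

theorem eq_zero_of_continuousAt_of_dense {f : M → ℝ} {x : M} (hf : ContinuousAt f x) {S : Set M}
    (hS : Dense S) (h : ∀ y ∈ S, f y = 0) : f x = 0 := by
  have : (𝓝[S] x).NeBot := mem_closure_iff_nhdsWithin_neBot.1 (hS x)
  refine tendsto_nhds_unique_of_eventuallyEq (hf.mono_left nhdsWithin_le_nhds)
    tendsto_const_nhds (l := 𝓝[S] x) ?_
  filter_upwards [self_mem_nhdsWithin] with y hy using h y hy

theorem along_zero (Z : VField E M) : along Z (0 : M → ℝ) = 0 := by
  funext x
  change mvfderiv 𝓘(ℝ, E) (0 : M → ℝ) x (Z x) = 0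
  rw [mvfderiv_zero]
  rfl

variable [IsManifold 𝓘(ℝ, E) ∞ M] {P : CoMap E M} {N : EndField E M}

/-- A 1-form is of class `C^n` at `x`. -/
def Form1.IsContMDiffAt (α : Form1 E M) (n : WithTop ℕ∞) (x : M) : Prop :=
  ContMDiffAt 𝓘(ℝ, E) (𝓘(ℝ, E).prod 𝓘(ℝ, E →L[ℝ] ℝ)) n
    (fun x : M ↦ TotalSpace.mk' (E →L[ℝ] ℝ)
      (E := fun x : M ↦ TangentSpace 𝓘(ℝ, E) x →L[ℝ] ℝ) x (α x)) x

/-- A vector field is of class `C^n` at `x`. -/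
def VField.IsContMDiffAt (X : VField E M) (n : WithTop ℕ∞) (x : M) : Prop :=
  ContMDiffAt 𝓘(ℝ, E) (𝓘(ℝ, E).prod 𝓘(ℝ, E)) n
    (fun x : M ↦ TotalSpace.mk' E (E := fun x : M ↦ TangentSpace 𝓘(ℝ, E) x) x (X x)) x

/-- Eigenvalues are only `C¹`, so their differentials are merely continuous, which is enough for the
density arguments. -/
theorem diff_isContMDiffAt {f : M → ℝ} {x : M} (hf : ContMDiffAt 𝓘(ℝ, E) 𝓘(ℝ) 1 f x) :
    (diff f : Form1 E M).IsContMDiffAt 0 x := by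
  have : IsManifold 𝓘(ℝ, E) 1 M := .of_le (n := ∞) (by simp)
  refine (contMDiffAt_hom_bundle _).2 ⟨contMDiffAt_id, ?_⟩
  refine (hf.mfderiv_const (m := 0) (by simp)).congr_of_eventuallyEq (Eventually.of_forall ?_)
  intro y
  ext u
  simp [inTangentCoordinates, ContinuousLinearMap.inCoordinates, diff, mvfderiv]
  rfl

theorem VField.IsContMDiffAt.app {X : VField E M} {n : WithTop ℕ∞} (hn : n ≤ ∞) {x : M}
    (hX : X.IsContMDiffAt n x) (hN : N.IsSmooth) : (N.app X).IsContMDiffAt n x :=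
  ((hN x).of_le hn).clm_bundle_apply hX

theorem Form1.IsContMDiffAt.hierarchy_app {α : Form1 E M} {n : WithTop ℕ∞} (hn : n ≤ ∞) {x : M}
    (hα : α.IsContMDiffAt n x) (hP : P.IsSmooth) (hN : N.IsSmooth) (j : ℕ) :
    ((hierarchy P N j).app α).IsContMDiffAt n x := by
  induction j with
  | zero => exact ((hP x).of_le hn).clm_bundle_apply hα
  | succ j ih => exact ih.app hn hN

theorem Form1.IsContMDiffAt.continuousAt_eval {α : Form1 E M} {X : VField E M} {x : M}
    (hα : α.IsContMDiffAt 0 x) (hX : X.IsContMDiffAt 0 x) : ContinuousAt (α.eval X) x := by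
  have h : ContMDiffAt 𝓘(ℝ, E) (𝓘(ℝ, E).prod 𝓘(ℝ, ℝ)) 0
      (fun m ↦ TotalSpace.mk' ℝ (E := Bundle.Trivial M ℝ) m (α m (X m))) x :=
    ContMDiffAt.clm_bundle_apply (E₂ := Bundle.Trivial M ℝ) hα hX
  rw [contMDiffAt_totalSpace] at h
  exact h.2.continuousAt

/-- Cartan's formula: `L_X β = ι_X dβ + d(β(X))`, and both terms vanish. -/
theorem lieD_eq_zero {X Z : VField E M} {β : Form1 E M} (hβ : β ∈ hamiltonianForms N)
    (hX : X.IsSmooth) (hZ : Z.IsSmooth) (h0 : β.eval X = 0) : lieD X β Z = 0 := by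
  have h := (hβ.2 X Z hX hZ).1
  have h1 : along Z (β.eval X) = 0 := by
    rw [h0, along_zero]
  rwa [extD, h1, sub_zero] at h

variable [FiniteDimensional ℝ E] [T2Space M] {σ : BilinField E M} {M₀ : Set M}
  {l : Fin (finrank ℝ E / 2) → M → ℝ}

theorem IsNijenhuisEigenvalues.dual_diff (hl : IsNijenhuisEigenvalues N M₀ l)
    (h : IsSymplecticPN σ P N) {x : M} (hx : x ∈ M₀) (i : Fin (finrank ℝ E / 2)) :
    N.dual (diff (l i)) x = l i x • diff (l i) x := by
  refine ContinuousLinearMap.ext fun u ↦ ?_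
  obtain ⟨X, hXs, hXu, -⟩ := exists_smooth_eventuallyEq (E := E) x u
  rw [← hXu]
  have hX : X.IsContMDiffAt 0 x := (hXs x).of_le (by simp)
  have hd := diff_isContMDiffAt (hl.contMDiffAt i hx)
  have hc := (hd.continuousAt_eval (hX.app (by simp) h.isPN.nijenhuis.smooth)).sub
    ((hl.contMDiffAt i hx).continuousAt.mul (hd.continuousAt_eval hX))
  have h0 := eq_zero_of_continuousAt_of_dense hc hl.dense_regularSet fun y hy ↦ ?_
  · exact sub_eq_zero.1 h0
  exact sub_eq_zero.2 (DFunLike.congr_fun (hl.dual_diff_of_regular h hy i) (X y))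

theorem IsNijenhuisEigenvalues.involution_of_regular (hl : IsNijenhuisEigenvalues N M₀ l)
    (h : IsSymplecticPN σ P N) {x : M} (hx : x ∈ regularSet M₀ l) (j : ℕ)
    (i k : Fin (finrank ℝ E / 2)) : diff (l k) x (hierarchy P N j x (diff (l i) x)) = 0 := by
  refine hierarchy_involution h.isPN.comm h.isPN.poisson.antisymm j
    (hl.dual_diff_of_regular h hx i) (hl.dual_diff_of_regular h hx k) ?_
  by_cases hik : i = k
  · exact .inr (by rw [hik])
  · exact .inl fun heq ↦ hik (hx.2 heq)

theorem IsNijenhuisEigenvalues.poisson_hierarchy_eq_zero (hl : IsNijenhuisEigenvalues N M₀ l)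
    (h : IsSymplecticPN σ P N) {x : M} (hx : x ∈ M₀) (j : ℕ) (i k : Fin (finrank ℝ E / 2)) :
    poisson (hierarchy P N j) (l i) (l k) x = 0 :=
  eq_zero_of_continuousAt_of_dense ((diff_isContMDiffAt (hl.contMDiffAt k hx)).continuousAt_eval
    ((diff_isContMDiffAt (hl.contMDiffAt i hx)).hierarchy_app (by simp) h.isPN.poisson.smooth
      h.isPN.nijenhuis.smooth j)) hl.dense_regularSet
        fun _ hy ↦ hl.involution_of_regular h hy j i k

theorem IsNijenhuisEigenvalues.pair_hierarchy_eq_zero (hl : IsNijenhuisEigenvalues N M₀ l)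
    (h : IsSymplecticPN σ P N) (j : ℕ) {α β : Form1 E M} (hα : α ∈ hamiltonianForms N)
    (hβ : β ∈ hamiltonianForms N) : (hierarchy P N j).pair α β = 0 := by
  funext x
  have hα0 : α.IsContMDiffAt 0 x := (hα.1 x).of_le (by simp)
  have hβ0 : β.IsContMDiffAt 0 x := (hβ.1 x).of_le (by simp)
  refine eq_zero_of_continuousAt_of_dense (hβ0.continuousAt_eval (hα0.hierarchy_app (by simp)
    h.isPN.poisson.smooth h.isPN.nijenhuis.smooth j)) hl.dense_regularSet fun y hy ↦ ?_
  obtain ⟨c, hc⟩ := hl.exists_eq_sum_of_regular h hy hα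
  obtain ⟨e, he⟩ := hl.exists_eq_sum_of_regular h hy hβ
  change β y (hierarchy P N j y (α y)) = 0
  rw [hc, he, sum_apply]
  refine Finset.sum_eq_zero fun k _ ↦ ?_
  rw [smul_apply, map_sum, map_sum, Finset.sum_eq_zero, smul_zero]
  intro i _
  rw [map_smul, map_smul, hl.involution_of_regular h hy, smul_zero]

end Continuity

end PoissonNijenhuis

end

/-! ### Conclusion -/

theorem mainTheorem3
    {E : Type*} [NormedAddCommGroup E] [NormedSpace ℝ E] [FiniteDimensional ℝ E]
    {M : Type*} [TopologicalSpace M] [T2Space M] [SecondCountableTopology M]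
    [ChartedSpace E M] [IsManifold 𝓘(ℝ, E) ∞ M]
    (σ : PoissonNijenhuis.BilinField E M) (P : PoissonNijenhuis.CoMap E M)
    (N : PoissonNijenhuis.EndField E M)
    (hPN : PoissonNijenhuis.IsSymplecticPN σ P N)
    (hN : PoissonNijenhuis.IsMaximalRank N) :
    (∀ (M₀ : Set M) (l : Fin (Module.finrank ℝ E / 2) → M → ℝ),
      PoissonNijenhuis.IsNijenhuisEigenvalues N M₀ l →
        (∀ i, ∀ x ∈ M₀,
          N.dual (PoissonNijenhuis.diff (l i)) x = l i x • PoissonNijenhuis.diff (l i) x) ∧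
        (∀ (j : ℕ) (i k), ∀ x ∈ M₀,
          PoissonNijenhuis.poisson (PoissonNijenhuis.hierarchy P N j) (l i) (l k) x = 0)) ∧
    (∀ (j : ℕ), ∀ α ∈ PoissonNijenhuis.hamiltonianForms N,
      ∀ β ∈ PoissonNijenhuis.hamiltonianForms N,
      ∀ Z : PoissonNijenhuis.VField E M, Z.IsSmooth →
        PoissonNijenhuis.koszul (PoissonNijenhuis.hierarchy P N j) α β Z = 0) := by
  refine ⟨fun M₀ l hl ↦ ⟨fun i x hx ↦ hl.dual_diff hPN hx i,
    fun j i k x hx ↦ hl.poisson_hierarchy_eq_zero hPN hx j i k⟩, fun j α hα β hβ Z hZ ↦ ?_⟩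
  obtain ⟨M₀, l, hl⟩ := hN
  have happ : ∀ γ ∈ PoissonNijenhuis.hamiltonianForms N,
      ((PoissonNijenhuis.hierarchy P N j).app γ).IsSmooth := fun γ hγ x ↦
    PoissonNijenhuis.Form1.IsContMDiffAt.hierarchy_app le_rfl (hγ.1 x)
      hPN.isPN.poisson.smooth hPN.isPN.nijenhuis.smooth j
  have h0 := hl.pair_hierarchy_eq_zero hPN j hα hβ
  have h1 := PoissonNijenhuis.lieD_eq_zero hβ (happ α hα) hZ h0
  have h2 := PoissonNijenhuis.lieD_eq_zero hα (happ β hβ) hZ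
    (hl.pair_hierarchy_eq_zero hPN j hβ hα)
  have h3 : PoissonNijenhuis.along Z ((PoissonNijenhuis.hierarchy P N j).pair α β) = 0 := by
    rw [h0, PoissonNijenhuis.along_zero]
  rw [PoissonNijenhuis.koszul, h1, h2, h3, sub_zero, sub_zero]
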